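/- Let $\mu$ be a probability law on $\mathbb{R}$ without atoms, with support $\mathbb{R}$ and with all moments finite, let $N\ge 2$, let $a_1,\dots,a_N$ be i.i.d. with law $\mu$ (scalar features, one data point per node and iteration, i.e. $d=b=1$), let $L$ be the graph Laplacian of a connected graph on $N$ nodes, let $\eta>0$ be the stepsize, and put $H=\mathrm{diag}(a_1^2,\dots,a_N^2)$. For $\delta>0$ let $W=I-\delta L$ and $$\hat h_\delta(s)=\mathbb{E}\big[\|W-\eta H\|^{s}\big],$$ with $\|\cdot\|$ the largest singular value, and let the tail-index $\hat\alpha(\delta)$ of decentralized SGD (DE-SGD) on least squares be the unique $\hat\alpha>0$ with $\hat h_\delta(\hat\alpha)=1$. Let the tail-index $\hat\alpha_C$ of centralized SGD (C-SGD), which uses all $N$ data points as one batch, be the unique $\hat\alpha_C>0$ with $\mathbb{E}\big[\,\big|1-\tfrac{\eta}{N}\sum_{j=1}^N a_j^2\big|^{\hat\alpha_C}\big]=1$. Assume $$\hat\rho_{dis}=\mathbb{E}\log\|I-\eta H\|=\mathbb{E}\Big[\log\max_{1\le i\le N}|1-\eta a_i^2|\Big]<0,$$ where the value $-\infty$ is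 allowed. Then $\hat\alpha_C$ exists, and there is $\delta_0>0$ (depending on $\mu$, $\eta$, $N$ and the graph) such that for every $\delta\in(0,\delta_0)$ the tail-index $\hat\alpha(\delta)$ exists and $$\hat\alpha(\delta)<\hat\alpha_C ,$$ i.e. DE-SGD has heavier tails than C-SGD. This holds for every such $\eta$ and $N$, in particular when the stepsize $\eta$ or the network size $N$ is large. -/

import Mathlib

open MeasureTheory

namespace DESGD

noncomputable section

/-- The stochastic Hessian `H = diag(a₁², …, a_N²)` of decentralized least squares with scalar
features and one data point per node (`d = 1`, `b = 1`). -/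
def hessian {N : ℕ} (a : Fin N → ℝ) : Matrix (Fin N) (Fin N) ℝ :=
  Matrix.diagonal fun i => a i ^ 2

/-- The mixing matrix `W = I - δ L`, where `L` is the graph Laplacian of the network. -/
def mixing {N : ℕ} (G : SimpleGraph (Fin N)) [DecidableRel G.Adj] (δ : ℝ) :
    Matrix (Fin N) (Fin N) ℝ :=
  1 - δ • G.lapMatrix ℝ

/-- The matrix 2-norm (largest singular value) of the iteration matrix `W - η H`. -/
def gain {N : ℕ} (W : Matrix (Fin N) (Fin N) ℝ) (η : ℝ) (a : Fin N → ℝ) : ℝ :=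
  ‖Matrix.toEuclideanCLM (𝕜 := ℝ) (W - η • hessian a)‖

/-- The joint law of the `n` i.i.d. scalar features used in one iteration; `μ` is the law of one
feature. -/
def dataLaw (μ : Measure ℝ) (n : ℕ) : Measure (Fin n → ℝ) :=
  Measure.pi fun _ => μ

/-- `ĥ(s) = 𝔼 ‖W - η H‖ ^ s`. -/
def hHat (μ : Measure ℝ) (η : ℝ) {N : ℕ} (W : Matrix (Fin N) (Fin N) ℝ) (s : ℝ) : ℝ :=
  ∫ a, gain W η a ^ s ∂(dataLaw μ N)

/-- `ρ̂ = 𝔼 log ‖W - η H‖`, as an extended real, the expectation of the positive part minus the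
expectation of the negative part. When the features have finite moments the first term is finite,
so that no `∞ - ∞` occurs and `-∞` is an admissible value; when `μ` has no atoms the norm vanishes
with probability zero (for `N ≥ 1`, `η > 0`), so that the convention `log 0 = 0` plays no role. -/
def rhoHat (μ : Measure ℝ) (η : ℝ) {N : ℕ} (W : Matrix (Fin N) (Fin N) ℝ) : EReal :=
  ((∫⁻ a, ENNReal.ofReal (Real.log (gain W η a)) ∂(dataLaw μ N) : ENNReal) : EReal)
    - ((∫⁻ a, ENNReal.ofReal (-Real.log (gain W η a)) ∂(dataLaw μ N) : ENNReal) : EReal)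

/-- `𝔼 |1 - (η / m) ∑ⱼ aⱼ²| ^ s`, the function `ĥ` of centralized SGD with batch-size `m`, for
which the iteration matrix is the scalar `1 - (η / m) ∑ⱼ aⱼ²`. -/
def hHatCentral (μ : Measure ℝ) (η : ℝ) (m : ℕ) (s : ℝ) : ℝ :=
  ∫ a, |1 - η / (m : ℝ) * ∑ j : Fin m, a j ^ 2| ^ s ∂(dataLaw μ m)

/-- `α` is the tail-index (proxy) belonging to `h`: the unique positive root of `h(α) = 1`. -/
def IsTailIndex (h : ℝ → ℝ) (α : ℝ) : Prop :=
  0 < α ∧ h α = 1 ∧ ∀ β : ℝ, 0 < β → h β = 1 → β = α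

end

end DESGD

open Filter Topology

namespace DESGD

/-! ### Moments of a nonnegative random variable as a function of the exponent -/

/-! For `W = I` the norm dominates every `|1 - η aᵢ²|`, hence also the absolute value of their mean
`1 - (η/N) ∑ aⱼ²`, strictly on a nonempty open set. So the moment function at `δ = 0` exceeds the
centralized one at every positive exponent (`hHatCentral_lt_hHat_one`), in particular at `αC`, where
it is above `1`. Negative mean logarithm puts it below `1` at some `s > 0`
(`exists_integral_rpow_lt_one`). These are strict inequalities at two fixed exponents, so they
survive for small `δ` by dominated convergence (`tendsto_hHat_mixing`). Moment functions are convex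
in the exponent and equal `1` at `0`, so the two inequalities force a unique positive root, lying
below `αC` (`exists_isTailIndex`). -/

theorem convexOn_rpow_exponent {x : ℝ} (hx : 0 ≤ x) :
    ConvexOn ℝ (Set.Ici 0) (fun s : ℝ => x ^ s) := by
  -- For `x = 0` the function is `1` at `0` and `0` afterwards: convex on `[0, ∞)` despite the jump.
  rcases hx.eq_or_lt with rfl | hx
  · refine ⟨convex_Ici 0, fun s hs t ht a b ha hb hab => ?_⟩
    simp only [Set.mem_Ici, smul_eq_mul] at *
    rcases eq_or_ne (a * s + b * t) 0 with h | h
    · have h1 : a * s = 0 := by nlinarith [mul_nonneg ha hs, mul_nonneg hb ht]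
      have h2 : b * t = 0 := by linarith
      rw [h, Real.rpow_zero]
      rcases mul_eq_zero.1 h1 with h1 | h1 <;> rcases mul_eq_zero.1 h2 with h2 | h2 <;>
        subst h1 <;> subst h2 <;> simp_all
    · rw [Real.zero_rpow h]
      positivity
  · exact (convexOn_rpow_left hx).subset (Set.subset_univ _) (convex_Ici 0)

section Moments

variable {Ω : Type*} [MeasurableSpace Ω] {P : Measure Ω} {g : Ω → ℝ}

theorem convexOn_integral_rpow (hg0 : ∀ ω, 0 ≤ g ω)
    (hint : ∀ s : ℝ, 0 ≤ s → Integrable (fun ω => g ω ^ s) P) :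
    ConvexOn ℝ (Set.Ici 0) (fun s : ℝ => ∫ ω, g ω ^ s ∂P) := by
  refine ⟨convex_Ici 0, fun s hs t ht a b ha hb hab => ?_⟩
  simp only [smul_eq_mul]
  rw [← integral_const_mul, ← integral_const_mul,
    ← integral_add ((hint s hs).const_mul a) ((hint t ht).const_mul b)]
  refine integral_mono (hint _ ((convex_Ici (0 : ℝ)) hs ht ha hb hab))
    (((hint s hs).const_mul a).add ((hint t ht).const_mul b)) fun ω => ?_
  exact (convexOn_rpow_exponent (hg0 ω)).2 hs ht ha hb hab

/-- Markov's inequality bounds the `s`-th moment below by `2 ^ s * P(g ≥ 2)`, which tends to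
infinity. -/
theorem exists_one_lt_integral_rpow [IsFiniteMeasure P] (hg0 : ∀ ω, 0 ≤ g ω)
    (hint : ∀ s : ℝ, 0 ≤ s → Integrable (fun ω => g ω ^ s) P)
    (hbig : P {ω | 2 ≤ g ω} ≠ 0) (s₀ : ℝ) :
    ∃ s : ℝ, s₀ < s ∧ 1 < ∫ ω, g ω ^ s ∂P := by
  have hpos : 0 < P.real {ω | 2 ≤ g ω} :=
    ENNReal.toReal_pos hbig (measure_ne_top _ _)
  have hlim : Tendsto (fun s : ℝ => (2 : ℝ) ^ s * P.real {ω | 2 ≤ g ω}) atTop atTop :=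
    (tendsto_rpow_atTop_of_base_gt_one 2 one_lt_two).atTop_mul_const hpos
  obtain ⟨s, h1, h2, h3⟩ := ((hlim.eventually_gt_atTop 1).and
    ((eventually_gt_atTop s₀).and (eventually_gt_atTop 0))).exists
  refine ⟨s, h2, h1.trans_le ?_⟩
  refine le_trans ?_ (mul_meas_ge_le_integral_of_nonneg
    (Eventually.of_forall fun ω => Real.rpow_nonneg (hg0 ω) s) (hint s h3.le) ((2 : ℝ) ^ s))
  refine mul_le_mul_of_nonneg_left (measureReal_mono fun ω hω => ?_) (by positivity)
  exact Real.rpow_le_rpow zero_le_two hω h3.le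

/-- If every small moment is at least `1`, the negative part of the logarithm is dominated in mean
by the positive part. -/
theorem exists_integral_rpow_lt_one [IsProbabilityMeasure P] (hgm : Measurable g) (hg0 : ∀ᵐ ω ∂P, 0 < g ω)
    (hint : ∀ s : ℝ, 0 ≤ s → Integrable (fun ω => g ω ^ s) P)
    (hlog : ((∫⁻ ω, ENNReal.ofReal (Real.log (g ω)) ∂P : ENNReal) : EReal)
      - ((∫⁻ ω, ENNReal.ofReal (-Real.log (g ω)) ∂P : ENNReal) : EReal) < 0) :
    ∃ s : ℝ, 0 < s ∧ ∫ ω, g ω ^ s ∂P < 1 := by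
  by_contra! hge
  set p : ℕ → ℝ := fun n => 1 / ((n : ℝ) + 1) with hp
  have hp0 : ∀ n, 0 < p n := fun n => by positivity
  have hp1 : ∀ n, p n ≤ 1 := fun n => by
    rw [hp]; exact (div_le_one (by positivity)).2 (by linarith [n.cast_nonneg (α := ℝ)])
  have hplim : Tendsto p atTop (𝓝[>] 0) :=
    tendsto_nhdsWithin_iff.2 ⟨tendsto_one_div_add_atTop_nhds_zero_nat,
      Eventually.of_forall hp0⟩
  -- Difference quotients of `s ↦ g ^ s` at `0`: they tend to `log g`, and Bernoulli's inequality
  -- bounds them above by `g`.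
  set F : ℕ → Ω → ℝ := fun n ω => (p n)⁻¹ * (g ω ^ p n - 1) with hF
  have hFm : ∀ n, Measurable (F n) := fun n => by fun_prop
  have hFint : ∀ n, Integrable (F n) P := fun n =>
    ((hint _ (hp0 n).le).sub (integrable_const 1)).const_mul _
  have hFlim : ∀ᵐ ω ∂P, Tendsto (fun n => F n ω) atTop (𝓝 (Real.log (g ω))) := by
    filter_upwards [hg0] with ω hω
    exact (tendsto_rpow_sub_one_log hω).comp hplim
  have hFle : ∀ᵐ ω ∂P, ∀ n, F n ω ≤ g ω := by
    filter_upwards [hg0] with ω hω n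
    have h2 : g ω ^ p n ≤ 1 + p n * (g ω - 1) := by
      have := rpow_one_add_le_one_add_mul_self (s := g ω - 1) (by linarith)
        (hp0 n).le (hp1 n)
      simpa using this
    have h3 : F n ω ≤ (p n)⁻¹ * (p n * (g ω - 1)) :=
      mul_le_mul_of_nonneg_left (by linarith) (inv_nonneg.2 (hp0 n).le)
    rw [inv_mul_cancel_left₀ (hp0 n).ne'] at h3
    linarith
  have hpos_lim : Tendsto (fun n => ∫⁻ ω, ENNReal.ofReal (F n ω) ∂P) atTop
      (𝓝 (∫⁻ ω, ENNReal.ofReal (Real.log (g ω)) ∂P)) := by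
    refine tendsto_lintegral_of_dominated_convergence (fun ω => ENNReal.ofReal (g ω))
      (fun n => (hFm n).ennreal_ofReal) (fun n => ?_) ?_ ?_
    · filter_upwards [hFle] with ω hω using ENNReal.ofReal_le_ofReal (hω n)
    · have := (hint 1 zero_le_one).lintegral_lt_top
      simpa using this.ne
    · filter_upwards [hFlim] with ω hω using ENNReal.tendsto_ofReal hω
  have hneg_le : ∀ n, ∫⁻ ω, ENNReal.ofReal (-F n ω) ∂P ≤ ∫⁻ ω, ENNReal.ofReal (F n ω) ∂P := by
    intro n
    have h0 : 0 ≤ ∫ ω, F n ω ∂P := by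
      rw [hF, integral_const_mul, integral_sub (hint _ (hp0 n).le) (integrable_const 1)]
      have := hge (p n) (hp0 n)
      refine mul_nonneg (inv_nonneg.2 (hp0 n).le) ?_
      simpa using this
    rw [integral_eq_lintegral_pos_part_sub_lintegral_neg_part (hFint n), sub_nonneg] at h0
    exact (ENNReal.toReal_le_toReal (hFint n).neg.lintegral_lt_top.ne
      (hFint n).lintegral_lt_top.ne).1 h0
  -- The negative parts have no dominating function, since `log g` may have mean `-∞`; Fatou
  -- suffices.
  have hfatou : ∫⁻ ω, ENNReal.ofReal (-Real.log (g ω)) ∂P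
      ≤ ∫⁻ ω, ENNReal.ofReal (Real.log (g ω)) ∂P := by
    calc ∫⁻ ω, ENNReal.ofReal (-Real.log (g ω)) ∂P
        = ∫⁻ ω, liminf (fun n => ENNReal.ofReal (-F n ω)) atTop ∂P := by
          refine lintegral_congr_ae ?_
          filter_upwards [hFlim] with ω hω
          exact (ENNReal.tendsto_ofReal hω.neg).liminf_eq.symm
      _ ≤ liminf (fun n => ∫⁻ ω, ENNReal.ofReal (-F n ω) ∂P) atTop :=
          lintegral_liminf_le fun n => (hFm n).neg.ennreal_ofReal
      _ ≤ liminf (fun n => ∫⁻ ω, ENNReal.ofReal (F n ω) ∂P) atTop :=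
          liminf_le_liminf (Eventually.of_forall hneg_le)
      _ = _ := hpos_lim.liminf_eq
  have hfin : ∫⁻ ω, ENNReal.ofReal (Real.log (g ω)) ∂P ≠ ⊤ := by
    refine ((lintegral_mono_ae ?_).trans_lt (hint 1 zero_le_one).lintegral_lt_top).ne
    filter_upwards [hg0] with ω hω
    rw [Real.rpow_one]
    exact ENNReal.ofReal_le_ofReal (Real.log_le_self hω.le)
  refine hlog.not_ge ((EReal.sub_nonneg (.inl ?_) (.inl ?_)).2 ?_)
  · simpa using hfin
  · simp
  · exact_mod_cast hfatou

end Moments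

/-! ### Roots of a convex function with value `1` at the origin -/

section Roots

variable {h : ℝ → ℝ}

/-- The graph lies below the chord from `(0, 1)` to `(s, h s)`. -/
theorem convexOn_lt_one_of_le (hc : ConvexOn ℝ (Set.Ici 0) h) (h0 : h 0 = 1) {s t : ℝ}
    (hs : h s < 1) (ht : 0 < t) (hts : t ≤ s) : h t < 1 := by
  have hs0 : 0 < s := ht.trans_le hts
  have := hc.2 (Set.mem_Ici.2 le_rfl) (Set.mem_Ici.2 hs0.le)
    (sub_nonneg.2 ((div_le_one hs0).2 hts)) (by positivity : 0 ≤ t / s) (by ring)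
  simp only [smul_eq_mul, mul_zero, zero_add, h0, div_mul_cancel₀ _ hs0.ne'] at this
  have : 0 < t / s * (1 - h s) := mul_pos (by positivity) (by linarith)
  nlinarith

/-- The slope from `s` to `β` is positive, and slopes increase. This gives uniqueness of the root.
-/
theorem convexOn_one_lt_of_root_lt (hc : ConvexOn ℝ (Set.Ici 0) h) (h0 : h 0 = 1) {s β γ : ℝ}
    (hs0 : 0 < s) (hs : h s < 1) (hβ0 : 0 < β) (hβ : h β = 1) (hβγ : β < γ) : 1 < h γ := by
  have hsβ : s < β := by
    by_contra! hle
    exact (convexOn_lt_one_of_le hc h0 hs hβ0 hle).ne hβ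
  have h1 := hc.slope_mono_adjacent (Set.mem_Ici.2 hs0.le)
    (Set.mem_Ici.2 (hβ0.trans hβγ).le) hsβ hβγ
  have h2 : 0 < (h β - h s) / (β - s) := div_pos (by linarith) (by linarith)
  have h3 := h2.trans_le h1
  rw [div_pos_iff_of_pos_right (by linarith)] at h3
  linarith

theorem exists_isTailIndex (hc : ConvexOn ℝ (Set.Ici 0) h) (h0 : h 0 = 1) {s t : ℝ}
    (hs0 : 0 < s) (hs : h s < 1) (ht0 : 0 < t) (ht : 1 < h t) :
    ∃ α, IsTailIndex h α ∧ α < t := by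
  have hst : s < t := by
    by_contra! hle
    exact lt_asymm ht (convexOn_lt_one_of_le hc h0 hs ht0 hle)
  -- Convexity gives continuity only in the interior; a jump at `0` is harmless as `s > 0`.
  have hcont : ContinuousOn h (Set.Ioi 0) :=
    (hc.subset Set.Ioi_subset_Ici_self (convex_Ioi 0)).continuousOn isOpen_Ioi
  obtain ⟨α, ⟨hα1, hα2⟩, hα⟩ := intermediate_value_Ioo hst.le
    (hcont.mono fun x hx => hs0.trans_le hx.1) (⟨hs, ht⟩ : (1 : ℝ) ∈ Set.Ioo (h s) (h t))
  refine ⟨α, ⟨hs0.trans hα1, hα, fun β hβ0 hβ => ?_⟩, hα2⟩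
  rcases lt_trichotomy β α with hlt | heq | hlt
  · exact absurd hα (convexOn_one_lt_of_root_lt hc h0 hs0 hs hβ0 hβ hlt).ne'
  · exact heq
  · exact absurd hβ (convexOn_one_lt_of_root_lt hc h0 hs0 hs (hs0.trans hα1) hα hlt).ne'

end Roots

/-! ### The norm of the iteration matrix -/

section Gain

variable {N : ℕ}

theorem hessian_eq_sum (a : Fin N → ℝ) :
    hessian a = ∑ i, a i ^ 2 • Matrix.single i i (1 : ℝ) := by
  ext j k
  simp [hessian, Matrix.diagonal_apply, Matrix.sum_apply, Matrix.single_apply, ite_and]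

/-- With fixed operators and scalar coefficients, continuity in `a` and `δ` and the
triangle-inequality bound become immediate. -/
theorem gain_mixing (G : SimpleGraph (Fin N)) [DecidableRel G.Adj] (δ η : ℝ) (a : Fin N → ℝ) :
    gain (mixing G δ) η a = ‖(1 : EuclideanSpace ℝ (Fin N) →L[ℝ] EuclideanSpace ℝ (Fin N))
      - δ • Matrix.toEuclideanCLM (𝕜 := ℝ) (G.lapMatrix ℝ)
      - η • ∑ i, a i ^ 2 • Matrix.toEuclideanCLM (𝕜 := ℝ) (Matrix.single i i (1 : ℝ))‖ := by
  rw [gain, mixing, hessian_eq_sum]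
  simp only [map_sub, map_smul, map_sum, map_one]

theorem mixing_zero (G : SimpleGraph (Fin N)) [DecidableRel G.Adj] : mixing G 0 = 1 := by
  simp [mixing]

theorem continuous_gain_mixing (G : SimpleGraph (Fin N)) [DecidableRel G.Adj] (δ η : ℝ) :
    Continuous (gain (mixing G δ) η) := by
  simp_rw [funext (gain_mixing G δ η)]
  fun_prop

theorem continuous_gain_mixing_weight (G : SimpleGraph (Fin N)) [DecidableRel G.Adj] (η : ℝ)
    (a : Fin N → ℝ) : Continuous (fun δ => gain (mixing G δ) η a) := by
  simp_rw [gain_mixing]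
  fun_prop

theorem gain_nonneg (W : Matrix (Fin N) (Fin N) ℝ) (η : ℝ) (a : Fin N → ℝ) : 0 ≤ gain W η a :=
  norm_nonneg _

theorem exists_gain_mixing_le (G : SimpleGraph (Fin N)) [DecidableRel G.Adj] (η : ℝ) :
    ∃ A B : ℝ, 0 ≤ A ∧ 0 ≤ B ∧ ∀ δ : ℝ, |δ| ≤ 1 → ∀ a : Fin N → ℝ,
      gain (mixing G δ) η a ≤ A + B * ∑ i, a i ^ 2 := by
  set L := Matrix.toEuclideanCLM (𝕜 := ℝ) (G.lapMatrix ℝ) with hL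
  set D : Fin N → (EuclideanSpace ℝ (Fin N) →L[ℝ] EuclideanSpace ℝ (Fin N)) :=
    fun i => Matrix.toEuclideanCLM (𝕜 := ℝ) (Matrix.single i i (1 : ℝ)) with hD
  refine ⟨‖(1 : EuclideanSpace ℝ (Fin N) →L[ℝ] EuclideanSpace ℝ (Fin N))‖ + ‖L‖,
    |η| * ∑ i, ‖D i‖, by positivity, by positivity, fun δ hδ a => ?_⟩
  rw [gain_mixing]
  refine (norm_sub_le _ _).trans (add_le_add ((norm_sub_le _ _).trans ?_) ?_)
  · gcongr
    rw [norm_smul, Real.norm_eq_abs]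
    exact mul_le_of_le_one_left (norm_nonneg _) hδ
  · rw [norm_smul, Real.norm_eq_abs, mul_assoc, Finset.mul_sum]
    gcongr
    refine (norm_sum_le _ _).trans (Finset.sum_le_sum fun i _ => ?_)
    rw [norm_smul, Real.norm_eq_abs, abs_of_nonneg (sq_nonneg _), mul_comm]
    gcongr
    exact Finset.single_le_sum (f := fun i => ‖D i‖) (fun j _ => norm_nonneg _)
      (Finset.mem_univ i)

theorem abs_one_sub_le_gain (η : ℝ) (a : Fin N → ℝ) (i : Fin N) :
    |1 - η * a i ^ 2| ≤ gain (1 : Matrix (Fin N) (Fin N) ℝ) η a := by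
  set T := Matrix.toEuclideanCLM (𝕜 := ℝ) (1 - η • hessian a) with hT
  -- Testing on the `i`-th basis vector gives the only half of "norm = max" that is needed.
  have h1 : ‖T (EuclideanSpace.single i 1)‖ ≤ ‖T‖ := by
    simpa using T.le_opNorm (EuclideanSpace.single i 1)
  have h2 : (T (EuclideanSpace.single i 1)) i = 1 - η * a i ^ 2 := by
    rw [hT, Matrix.ofLp_toEuclideanCLM]
    simp [hessian]
  rw [← h2, ← Real.norm_eq_abs]
  exact (PiLp.norm_apply_le _ i).trans h1

/-- The iteration factor of centralized SGD is a mean of the factors `1 - η aᵢ²`. -/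
theorem abs_centralized_le_gain (hN : N ≠ 0) (η : ℝ) (a : Fin N → ℝ) :
    |1 - η / (N : ℝ) * ∑ j, a j ^ 2| ≤ gain (1 : Matrix (Fin N) (Fin N) ℝ) η a := by
  have hN' : (0 : ℝ) < N := by positivity
  have h : 1 - η / (N : ℝ) * ∑ j, a j ^ 2 = (∑ j, (1 - η * a j ^ 2)) / N := by
    rw [Finset.sum_sub_distrib, ← Finset.mul_sum]
    simp
    field_simp
  rw [h, abs_div, abs_of_pos hN', div_le_iff₀ hN']
  calc |∑ j, (1 - η * a j ^ 2)| ≤ ∑ j, |1 - η * a j ^ 2| := Finset.abs_sum_le_sum_abs _ _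
    _ ≤ ∑ _j : Fin N, gain (1 : Matrix (Fin N) (Fin N) ℝ) η a :=
        Finset.sum_le_sum fun j _ => abs_one_sub_le_gain η a j
    _ = gain (1 : Matrix (Fin N) (Fin N) ℝ) η a * N := by simp [mul_comm]

end Gain

/-! ### The law of the data -/

section Law

variable {μ : Measure ℝ} [IsProbabilityMeasure μ] {N : ℕ}

instance (n : ℕ) : IsProbabilityMeasure (dataLaw μ n) := by
  unfold dataLaw; infer_instance

instance [μ.IsOpenPosMeasure] (n : ℕ) : (dataLaw μ n).IsOpenPosMeasure := by
  unfold dataLaw; infer_instance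

theorem integrable_quadratic_rpow (hmom : ∀ p : ℕ, Integrable (fun x : ℝ => |x| ^ p) μ)
    {A B : ℝ} (hA : 0 ≤ A) (hB : 0 ≤ B) {s : ℝ} (hs : 0 ≤ s) :
    Integrable (fun a : Fin N → ℝ => (A + B * ∑ i, a i ^ 2) ^ s) (dataLaw μ N) := by
  rcases hs.eq_or_lt with rfl | hs
  · simp
  obtain ⟨p, hp⟩ := exists_nat_ge s
  have hp0 : p ≠ 0 := by rintro rfl; simp at hp; linarith
  -- The moment of order `2p` controls the natural exponent `p ≥ s`; finiteness of the measure then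
  -- allows lowering `p` to `s`.
  have hsq : MemLp (fun x : ℝ => x ^ 2) p μ := by
    rw [← integrable_norm_rpow_iff (by fun_prop) (by simpa using hp0) (by simp)]
    refine (hmom (2 * p)).congr (Eventually.of_forall fun x => ?_)
    simp [pow_mul]
  have hsum : MemLp (fun a : Fin N → ℝ => A + B * ∑ i, a i ^ 2) p (dataLaw μ N) := by
    have hi : ∀ i ∈ (Finset.univ : Finset (Fin N)),
        MemLp (fun a : Fin N → ℝ => a i ^ 2) p (dataLaw μ N) := fun i _ =>
      hsq.comp_measurePreserving (measurePreserving_eval (fun _ : Fin N => μ) i)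
    exact (memLp_const A).add ((memLp_finsetSum _ hi).const_mul B)
  have hsum' := hsum.mono_exponent (p := ENNReal.ofReal s)
    (ENNReal.ofReal_le_of_le_toReal (by simpa using hp))
  have := hsum'.integrable_norm_rpow (by simpa using hs) ENNReal.ofReal_ne_top
  refine this.congr (Eventually.of_forall fun a => ?_)
  simp only [ENNReal.toReal_ofReal hs.le]
  rw [Real.norm_of_nonneg (by positivity)]

theorem integrable_gain_rpow (hmom : ∀ p : ℕ, Integrable (fun x : ℝ => |x| ^ p) μ)
    (G : SimpleGraph (Fin N)) [DecidableRel G.Adj] (η : ℝ) {δ : ℝ} (hδ : |δ| ≤ 1) {s : ℝ}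
    (hs : 0 ≤ s) : Integrable (fun a => gain (mixing G δ) η a ^ s) (dataLaw μ N) := by
  obtain ⟨A, B, hA, hB, hAB⟩ := exists_gain_mixing_le G η
  refine (integrable_quadratic_rpow hmom hA hB hs).mono'
    ((continuous_gain_mixing G δ η).rpow_const fun _ => .inr hs).aestronglyMeasurable
    (Eventually.of_forall fun a => ?_)
  rw [Real.norm_of_nonneg (Real.rpow_nonneg (gain_nonneg _ _ _) _)]
  exact Real.rpow_le_rpow (gain_nonneg _ _ _) (hAB δ hδ a) hs

theorem tendsto_hHat_mixing (hmom : ∀ p : ℕ, Integrable (fun x : ℝ => |x| ^ p) μ)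
    (G : SimpleGraph (Fin N)) [DecidableRel G.Adj] (η : ℝ) {s : ℝ} (hs : 0 ≤ s) :
    Tendsto (fun δ => hHat μ η (mixing G δ) s) (𝓝 0)
      (𝓝 (hHat μ η (1 : Matrix (Fin N) (Fin N) ℝ) s)) := by
  obtain ⟨A, B, hA, hB, hAB⟩ := exists_gain_mixing_le G η
  rw [← mixing_zero G]
  refine tendsto_integral_filter_of_dominated_convergence _ ?_ ?_
    (integrable_quadratic_rpow hmom hA hB hs) (Eventually.of_forall fun a => ?_)
  · exact Eventually.of_forall fun δ =>
      ((continuous_gain_mixing G δ η).rpow_const fun _ => .inr hs).aestronglyMeasurable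
  · filter_upwards [Metric.closedBall_mem_nhds (0 : ℝ) one_pos] with δ hδ
    refine Eventually.of_forall fun a => ?_
    rw [Real.norm_of_nonneg (Real.rpow_nonneg (gain_nonneg _ _ _) _)]
    exact Real.rpow_le_rpow (gain_nonneg _ _ _) (hAB δ (by simpa using hδ) a) hs
  · exact ((continuous_gain_mixing_weight G η a).rpow_const fun _ => .inr hs).tendsto 0

theorem convexOn_hHat_mixing (hmom : ∀ p : ℕ, Integrable (fun x : ℝ => |x| ^ p) μ)
    (G : SimpleGraph (Fin N)) [DecidableRel G.Adj] (η : ℝ) {δ : ℝ} (hδ : |δ| ≤ 1) :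
    ConvexOn ℝ (Set.Ici 0) (hHat μ η (mixing G δ)) :=
  convexOn_integral_rpow (fun _ => gain_nonneg _ _ _)
    fun _ hs => integrable_gain_rpow hmom G η hδ hs

theorem hHat_zero (η : ℝ) (W : Matrix (Fin N) (Fin N) ℝ) : hHat μ η W 0 = 1 := by
  simp [hHat]

theorem hHatCentral_zero (η : ℝ) (m : ℕ) : hHatCentral μ η m 0 = 1 := by
  simp [hHatCentral]

theorem gain_one_pos_ae [NullSingletonClass μ] (hN : N ≠ 0) (η : ℝ) :
    ∀ᵐ a ∂(dataLaw μ N), 0 < gain (1 : Matrix (Fin N) (Fin N) ℝ) η a := by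
  have i : Fin N := ⟨0, Nat.pos_of_ne_zero hN⟩
  -- A vanishing norm would force coordinate `i` into this finite set, which is null for an atomless
  -- law.
  have hfin : {x : ℝ | 1 - η * x ^ 2 = 0}.Finite := by
    have hsub : {x : ℝ | 1 - η * x ^ 2 = 0} ⊆ {√(1 / η), -√(1 / η)} := by
      intro x hx
      have hη : η ≠ 0 := by rintro rfl; simp at hx
      have hx' : x ^ 2 = 1 / η := by
        field_simp
        linarith [show 1 - η * x ^ 2 = 0 from hx]
      rw [← hx', Real.sqrt_sq_eq_abs]
      rcases abs_choice x with h | h <;> simp [h]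
    exact (Set.toFinite _).subset hsub
  have hae : ∀ᵐ x ∂μ, 1 - η * x ^ 2 ≠ 0 := by
    rw [ae_iff]
    simpa using hfin.measure_zero μ
  have := (measurePreserving_eval (fun _ : Fin N => μ) i).quasiMeasurePreserving.ae hae
  filter_upwards [this] with a ha
  exact (abs_pos.2 ha).trans_le (abs_one_sub_le_gain η a i)

theorem continuous_abs_centralized (η : ℝ) :
    Continuous fun a : Fin N → ℝ => |1 - η / (N : ℝ) * ∑ j, a j ^ 2| := by
  fun_prop

theorem integrable_centralized_rpow (hmom : ∀ p : ℕ, Integrable (fun x : ℝ => |x| ^ p) μ)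
    (hN : N ≠ 0) (η : ℝ) {s : ℝ} (hs : 0 ≤ s) :
    Integrable (fun a : Fin N → ℝ => |1 - η / (N : ℝ) * ∑ j, a j ^ 2| ^ s) (dataLaw μ N) := by
  -- At `δ = 0` the graph is irrelevant, so `⊥` serves to reach `W = I`.
  have h := integrable_gain_rpow (N := N) hmom ⊥ η (δ := 0) (by simp) hs
  rw [mixing_zero] at h
  refine h.mono' ((continuous_abs_centralized η).rpow_const
    fun _ => .inr hs).aestronglyMeasurable (Eventually.of_forall fun a => ?_)
  rw [Real.norm_of_nonneg (Real.rpow_nonneg (abs_nonneg _) _)]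
  exact Real.rpow_le_rpow (abs_nonneg _) (abs_centralized_le_gain hN η a) hs

theorem convexOn_hHatCentral (hmom : ∀ p : ℕ, Integrable (fun x : ℝ => |x| ^ p) μ)
    (hN : N ≠ 0) (η : ℝ) : ConvexOn ℝ (Set.Ici 0) (hHatCentral μ η N) :=
  convexOn_integral_rpow (fun _ => abs_nonneg _)
    fun _ hs => integrable_centralized_rpow hmom hN η hs

theorem hHatCentral_le_hHat_one (hmom : ∀ p : ℕ, Integrable (fun x : ℝ => |x| ^ p) μ)
    (hN : N ≠ 0) (η : ℝ) {s : ℝ} (hs : 0 ≤ s) :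
    hHatCentral μ η N s ≤ hHat μ η (1 : Matrix (Fin N) (Fin N) ℝ) s := by
  have h := integrable_gain_rpow (N := N) hmom ⊥ η (δ := 0) (by simp) hs
  rw [mixing_zero] at h
  exact integral_mono (integrable_centralized_rpow hmom hN η hs) h fun a =>
    Real.rpow_le_rpow (abs_nonneg _) (abs_centralized_le_gain hN η a) hs

theorem hHatCentral_lt_hHat_one [μ.IsOpenPosMeasure]
    (hmom : ∀ p : ℕ, Integrable (fun x : ℝ => |x| ^ p) μ)
    (hN : 2 ≤ N) {η : ℝ} (hη : 0 < η) {s : ℝ} (hs : 0 < s) :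
    hHatCentral μ η N s < hHat μ η (1 : Matrix (Fin N) (Fin N) ℝ) s := by
  have hN0 : N ≠ 0 := by omega
  have hG := integrable_gain_rpow (N := N) hmom ⊥ η (δ := 0) (by simp) hs.le
  have hGc := continuous_gain_mixing (N := N) ⊥ 0 η
  rw [mixing_zero] at hG hGc
  have hC := integrable_centralized_rpow hmom hN0 η hs.le
  rw [← sub_pos, hHat, hHatCentral, ← integral_sub hG hC]
  refine (integral_pos_iff_support_of_nonneg (fun a => sub_nonneg.2 (Real.rpow_le_rpow
    (abs_nonneg _) (abs_centralized_le_gain hN0 η a) hs.le)) (hG.sub hC)).2 ?_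
  have hopen : IsOpen {a : Fin N → ℝ | |1 - η / (N : ℝ) * ∑ j, a j ^ 2|
      < gain (1 : Matrix (Fin N) (Fin N) ℝ) η a} :=
    isOpen_lt (continuous_abs_centralized η) hGc
  have hNR : (2 : ℝ) ≤ N := by exact_mod_cast hN
  have hne : {a : Fin N → ℝ | |1 - η / (N : ℝ) * ∑ j, a j ^ 2|
      < gain (1 : Matrix (Fin N) (Fin N) ℝ) η a}.Nonempty := by
    -- Here the centralized factor is `1 - 1/N`, while a node with zero data makes the norm at least
    -- `1`; such a node exists because `N ≥ 2`.
    refine ⟨Pi.single ⟨0, by omega⟩ (√(1 / η)), ?_⟩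
    have h1 := abs_one_sub_le_gain η (Pi.single ⟨0, by omega⟩ (√(1 / η)))
      (⟨1, by omega⟩ : Fin N)
    rw [Pi.single_eq_of_ne (by simp)] at h1
    refine lt_of_lt_of_le ?_ h1
    have hsum : ∑ j : Fin N, (Pi.single (⟨0, by omega⟩ : Fin N) (√(1 / η)) : Fin N → ℝ) j ^ 2
        = 1 / η := by
      rw [Finset.sum_eq_single (⟨0, by omega⟩ : Fin N)]
      · rw [Pi.single_eq_same, Real.sq_sqrt (by positivity)]
      · intro j _ hj
        rw [Pi.single_eq_of_ne hj]; simp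
      · simp
    have hval : η / (N : ℝ) * (1 / η) = 1 / N := by field_simp
    rw [hsum, hval]
    have h2 : 0 < 1 / (N : ℝ) := by positivity
    have h3 : 1 / (N : ℝ) ≤ 1 := (div_le_one (by linarith)).2 (by linarith)
    rw [abs_of_nonneg (by linarith)]
    simpa using by linarith
  refine (hopen.measure_pos _ hne).trans_le (measure_mono fun a ha => ?_)
  exact (sub_pos.2 (Real.rpow_lt_rpow (abs_nonneg _) ha hs)).ne'

theorem measure_two_le_centralized_ne_zero [μ.IsOpenPosMeasure] (hN : N ≠ 0) {η : ℝ}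
    (hη : 0 < η) :
    dataLaw μ N {a : Fin N → ℝ | 2 ≤ |1 - η / (N : ℝ) * ∑ j, a j ^ 2|} ≠ 0 := by
  have hopen : IsOpen {a : Fin N → ℝ | 2 < |1 - η / (N : ℝ) * ∑ j, a j ^ 2|} :=
    isOpen_lt continuous_const (continuous_abs_centralized η)
  have hne : {a : Fin N → ℝ | 2 < |1 - η / (N : ℝ) * ∑ j, a j ^ 2|}.Nonempty := by
    -- The centralized factor is then `1 - 4 = -3`.
    refine ⟨fun _ => √(4 / η), ?_⟩
    have hN' : (N : ℝ) ≠ 0 := by exact_mod_cast hN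
    have hval : η / (N : ℝ) * ∑ _j : Fin N, √(4 / η) ^ 2 = 4 := by
      rw [Real.sq_sqrt (by positivity)]
      simp
      field_simp
    rw [Set.mem_ofPred_eq, hval]
    norm_num
  exact ((hopen.measure_pos _ hne).trans_le
    (measure_mono (Set.ofPred_subset_ofPred.2 fun a ha => ha.le))).ne'

end Law

end DESGD

theorem corollary2
    -- the common law of the i.i.d. scalar features: no atoms, support `ℝ`, all moments finite
    (μ : Measure ℝ) [IsProbabilityMeasure μ] [NullSingletonClass μ] [μ.IsOpenPosMeasure]
    (hmom : ∀ p : ℕ, Integrable (fun x : ℝ => |x| ^ p) μ)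
    -- the network
    (N : ℕ) (hN : 2 ≤ N) (G : SimpleGraph (Fin N)) [DecidableRel G.Adj] (hG : G.Connected)
    -- the stepsize, with `ρ̂_dis < 0` (the case `W = I`); every such `η` and `N` is covered, in
    -- particular large ones
    (η : ℝ) (hη : 0 < η)
    (hρ : DESGD.rhoHat μ η (1 : Matrix (Fin N) (Fin N) ℝ) < 0) :
    ∃ αC : ℝ, DESGD.IsTailIndex (DESGD.hHatCentral μ η N) αC ∧
      ∃ δ₀ : ℝ, 0 < δ₀ ∧ ∀ δ : ℝ, 0 < δ → δ < δ₀ →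
        ∃ α : ℝ, DESGD.IsTailIndex (DESGD.hHat μ η (DESGD.mixing G δ)) α ∧ α < αC := by
  have hN0 : N ≠ 0 := by omega
  obtain ⟨s, hs0, hs⟩ : ∃ s : ℝ, 0 < s ∧
      DESGD.hHat μ η (1 : Matrix (Fin N) (Fin N) ℝ) s < 1 := by
    have hcont := DESGD.continuous_gain_mixing G 0 η
    have hint := fun (s : ℝ) (hs : 0 ≤ s) =>
      DESGD.integrable_gain_rpow hmom G η (δ := 0) (by simp) hs
    rw [DESGD.mixing_zero] at hcont hint
    exact DESGD.exists_integral_rpow_lt_one hcont.measurable (DESGD.gain_one_pos_ae hN0 η) hint hρ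
  obtain ⟨t, ht0, ht⟩ : ∃ t : ℝ, 0 < t ∧ 1 < DESGD.hHatCentral μ η N t :=
    DESGD.exists_one_lt_integral_rpow (fun _ => abs_nonneg _)
      (fun _ hs => DESGD.integrable_centralized_rpow hmom hN0 η hs)
      (DESGD.measure_two_le_centralized_ne_zero hN0 hη) 0
  obtain ⟨αC, hαC, -⟩ := DESGD.exists_isTailIndex (DESGD.convexOn_hHatCentral hmom hN0 η)
    (DESGD.hHatCentral_zero η N) hs0
    ((DESGD.hHatCentral_le_hHat_one hmom hN0 η hs0.le).trans_lt hs) ht0 ht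
  have hgt : 1 < DESGD.hHat μ η (1 : Matrix (Fin N) (Fin N) ℝ) αC :=
    hαC.2.1 ▸ DESGD.hHatCentral_lt_hHat_one hmom hN hη hαC.1
  obtain ⟨ε, hε0, hε⟩ := Metric.eventually_nhds_iff.1
    (((DESGD.tendsto_hHat_mixing hmom G η hs0.le).eventually_lt_const hs).and
      ((DESGD.tendsto_hHat_mixing hmom G η hαC.1.le).eventually_const_lt hgt))
  -- The cap `1` keeps `δ` in the range of the uniform bound that yields integrability and
  -- convexity.
  refine ⟨αC, hαC, min ε 1, lt_min hε0 one_pos, fun δ hδ0 hδ => ?_⟩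
  obtain ⟨h1, h2⟩ := hε (y := δ) (by
    rw [Real.dist_0_eq_abs, abs_of_pos hδ0]; exact hδ.trans_le (min_le_left _ _))
  exact DESGD.exists_isTailIndex (DESGD.convexOn_hHat_mixing hmom G η
    (by rw [abs_of_pos hδ0]; exact hδ.le.trans (min_le_right _ _)))
    (DESGD.hHat_zero η _) hs0 h1 hαC.1 h2
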